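/- Let $\Omega\subset\mathbb R^d$, $d\in\{2,3\}$, be a bounded Lipschitz domain (more generally, $\Omega$ may be any open subset of $\mathbb R^d$ with $d$ arbitrary), let $1<p<\infty$, and let $Y=W^{1,p}(\Omega,\mathbb R^m)$ with the standard Sobolev norm $$\|y\|_Y=\Big(\int_\Omega|\nabla y|^p+|y|^p\,dx\Big)^{1/p},$$ where $|\nabla y|$ is the Frobenius norm and $|y|$ the Euclidean norm. Let $X$ be a reflexive real Banach space, $a\colon X\times Y\to\mathbb R$ a continuous bilinear form, $L\colon Y\to\mathbb R$ a continuous linear functional with $L\neq0$, and $P\subset X$ a closed convex set with $0_X\in P$. Put $$\lambda^*:=\sup_{x\in P}\ \inf_{\substack{y\in Y\\ L(y)=1}} a(x,y),\qquad \zeta^*:=\inf_{\substack{y\in Y\\ L(y)=1}}\ \sup_{x\in P} a(x,y)$$ (values in $[-\infty,+\infty]$). Assume that there are a closed, convex, bounded set $P_A\subset X$ and a closed convex cone $P_C\subset P$ with vertex at $0$ such that every $x\in P$ can be written as $x=x_A+x_C$ with $x_A\in P_A$, $x_C\in P_C$, and that $$\inf_{\substack{x_C\in P_C\\ x_C\neq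 0_X}}\ \sup_{\substack{y\in Y\\ y\neq0_Y}}\ \frac{a(x_C,y)}{\|x_C\|_X\|y\|_Y}>0$$ (with $\inf\emptyset=+\infty$). Then $\lambda^*=\zeta^*$. Moreover, if $\lambda^*<+\infty$, then the dual problem has a solution: $\lambda^*$ is a real number and there exists $\bar x\in P$ such that $a(\bar x,y)=\lambda^*L(y)$ for all $y\in Y$. -/

import Mathlib

open MeasureTheory TopologicalSpace
open scoped ENNReal ContDiff

noncomputable section

/-- `G` is the weak gradient of `u : Ω → ℝᵐ` on the open set `Ω ⊆ ℝᵈ`: for every scalar test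
function `φ ∈ C_c^∞(Ω)` and all `i, j`, `∫_Ω uᵢ ∂ⱼφ = - ∫_Ω Gᵢⱼ φ`. The values of `G` are
`m × d` matrices with the Frobenius norm, that is, elements of `EuclideanSpace ℝ (Fin m × Fin d)`. -/
def IsWeakGradient {d m : ℕ} (Ω : Opens (EuclideanSpace ℝ (Fin d)))
    (u : EuclideanSpace ℝ (Fin d) → EuclideanSpace ℝ (Fin m))
    (G : EuclideanSpace ℝ (Fin d) → EuclideanSpace ℝ (Fin m × Fin d)) : Prop :=
  ∀ φ : EuclideanSpace ℝ (Fin d) → ℝ, ContDiff ℝ ∞ φ → HasCompactSupport φ →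
    tsupport φ ⊆ (Ω : Set (EuclideanSpace ℝ (Fin d))) →
    ∀ (i : Fin m) (j : Fin d),
      ∫ x in (Ω : Set (EuclideanSpace ℝ (Fin d))),
          u x i * fderiv ℝ φ x (EuclideanSpace.single j 1) =
        - ∫ x in (Ω : Set (EuclideanSpace ℝ (Fin d))), G x (i, j) * φ x

/-- The product of a component of an `Lᵖ` function with a continuous, compactly supported
function is integrable. -/
theorem integrable_component_mul {d : ℕ} {ι : Type} [Fintype ι] {p : ℝ≥0∞} [hp : Fact (1 ≤ p)]
    (μ : Measure (EuclideanSpace ℝ (Fin d))) [IsFiniteMeasureOnCompacts μ]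
    (f : Lp (EuclideanSpace ℝ ι) p μ) (i : ι) {φ : EuclideanSpace ℝ (Fin d) → ℝ}
    (hφ : Continuous φ) (hc : HasCompactSupport φ) :
    Integrable (fun x => f x i * φ x) μ := by
  have h1 : MemLp (fun x => f x i) p μ := by
    have := (EuclideanSpace.proj i : EuclideanSpace ℝ ι →L[ℝ] ℝ).comp_memLp' (Lp.memLp f)
    exact this
  have h2 : MemLp φ p.conjExponent μ := hφ.memLp_of_hasCompactSupport hc
  have : p.HolderConjugate p.conjExponent := ENNReal.HolderConjugate.conjExponent hp.out
  exact h1.integrable_mul h2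

/-- `W^{1,p}(Ω, ℝᵐ)`, realised as the space of all pairs `(u, ∇u)` with `u ∈ Lᵖ(Ω, ℝᵐ)` whose weak
gradient `∇u` lies in `Lᵖ(Ω, ℝ^{m × d})`; as `∇u` is determined by `u`, such a pair is the same as
`u`. The ambient `p`-product norm restricts to `(‖u‖_{Lᵖ}^p + ‖∇u‖_{Lᵖ}^p)^{1/p}`. -/
def sobolevSubmodule (p : ℝ≥0∞) [Fact (1 ≤ p)] {d : ℕ} (Ω : Opens (EuclideanSpace ℝ (Fin d)))
    (m : ℕ) :
    Submodule ℝ (WithLp p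
      (Lp (EuclideanSpace ℝ (Fin m)) p
          (volume.restrict (Ω : Set (EuclideanSpace ℝ (Fin d)))) ×
        Lp (EuclideanSpace ℝ (Fin m × Fin d)) p
          (volume.restrict (Ω : Set (EuclideanSpace ℝ (Fin d)))))) where
  carrier := {w | IsWeakGradient Ω w.fst w.snd}
  zero_mem' := by
    intro φ _ _ _ i j
    have e1 : ∀ᵐ x ∂(volume.restrict (Ω : Set (EuclideanSpace ℝ (Fin d)))),
        (0 : Lp (EuclideanSpace ℝ (Fin m)) p
          (volume.restrict (Ω : Set (EuclideanSpace ℝ (Fin d))))) x i *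
            fderiv ℝ φ x (EuclideanSpace.single j 1) = 0 := by
      filter_upwards [Lp.coeFn_zero (EuclideanSpace ℝ (Fin m)) p
        (volume.restrict (Ω : Set (EuclideanSpace ℝ (Fin d))))] with x hx
      rw [hx]
      simp
    have e2 : ∀ᵐ x ∂(volume.restrict (Ω : Set (EuclideanSpace ℝ (Fin d)))),
        (0 : Lp (EuclideanSpace ℝ (Fin m × Fin d)) p
          (volume.restrict (Ω : Set (EuclideanSpace ℝ (Fin d))))) x (i, j) * φ x = 0 := by
      filter_upwards [Lp.coeFn_zero (EuclideanSpace ℝ (Fin m × Fin d)) p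
        (volume.restrict (Ω : Set (EuclideanSpace ℝ (Fin d))))] with x hx
      rw [hx]
      simp
    simp only [WithLp.zero_fst, WithLp.zero_snd]
    rw [integral_eq_zero_of_ae e1, integral_eq_zero_of_ae e2, neg_zero]
  add_mem' := by
    intro v w hv hw φ hφ hc hs i j
    have hd : Continuous (fun x => fderiv ℝ φ x (EuclideanSpace.single j 1)) :=
      (hφ.continuous_fderiv (by simp)).clm_apply continuous_const
    have hdc : HasCompactSupport (fun x => fderiv ℝ φ x (EuclideanSpace.single j 1)) :=
      hc.fderiv_apply ℝ _
    have e1 := Lp.coeFn_add v.fst w.fst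
    have e2 := Lp.coeFn_add v.snd w.snd
    have f1 : (fun x => (v.fst + w.fst) x i * fderiv ℝ φ x (EuclideanSpace.single j 1))
        =ᵐ[volume.restrict (Ω : Set (EuclideanSpace ℝ (Fin d)))]
        fun x => v.fst x i * fderiv ℝ φ x (EuclideanSpace.single j 1) +
          w.fst x i * fderiv ℝ φ x (EuclideanSpace.single j 1) := by
      filter_upwards [e1] with x hx
      rw [hx]
      simp [add_mul]
    have f2 : (fun x => (v.snd + w.snd) x (i, j) * φ x)
        =ᵐ[volume.restrict (Ω : Set (EuclideanSpace ℝ (Fin d)))]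
        fun x => v.snd x (i, j) * φ x + w.snd x (i, j) * φ x := by
      filter_upwards [e2] with x hx
      rw [hx]
      simp [add_mul]
    simp only [WithLp.add_fst, WithLp.add_snd]
    rw [integral_congr_ae f1, integral_congr_ae f2,
      integral_add (integrable_component_mul _ _ _ hd hdc)
        (integrable_component_mul _ _ _ hd hdc),
      integral_add (integrable_component_mul _ _ _ hφ.continuous hc)
        (integrable_component_mul _ _ _ hφ.continuous hc),
      hv φ hφ hc hs i j, hw φ hφ hc hs i j]
    ring
  smul_mem' := by
    intro c w hw φ hφ hc hs i j
    have f1 : (fun x => (c • w.fst) x i * fderiv ℝ φ x (EuclideanSpace.single j 1))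
        =ᵐ[volume.restrict (Ω : Set (EuclideanSpace ℝ (Fin d)))]
        fun x => c * (w.fst x i * fderiv ℝ φ x (EuclideanSpace.single j 1)) := by
      filter_upwards [Lp.coeFn_smul c w.fst] with x hx
      rw [hx]
      simp [mul_assoc]
    have f2 : (fun x => (c • w.snd) x (i, j) * φ x)
        =ᵐ[volume.restrict (Ω : Set (EuclideanSpace ℝ (Fin d)))]
        fun x => c * (w.snd x (i, j) * φ x) := by
      filter_upwards [Lp.coeFn_smul c w.snd] with x hx
      rw [hx]
      simp [mul_assoc]
    simp only [WithLp.smul_fst, WithLp.smul_snd]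
    rw [integral_congr_ae f1, integral_congr_ae f2, integral_const_mul, integral_const_mul,
      hw φ hφ hc hs i j]
    ring

/-- The Sobolev space `W^{1,p}(Ω, ℝᵐ)` as a normed space. -/
abbrev SobolevSpace (p : ℝ≥0∞) [Fact (1 ≤ p)] {d : ℕ} (Ω : Opens (EuclideanSpace ℝ (Fin d)))
    (m : ℕ) : Type :=
  sobolevSubmodule p Ω m

/-- The norm of `SobolevSpace p Ω m` is the standard one, `(∫_Ω |∇y|^p + |y|^p)^{1/p}`. -/
theorem SobolevSpace.norm_eq (p : ℝ≥0∞) [Fact (1 ≤ p)] (hp : p ≠ ⊤) {d : ℕ}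
    (Ω : Opens (EuclideanSpace ℝ (Fin d))) (m : ℕ) (y : SobolevSpace p Ω m) :
    ‖y‖ = (∫ x in (Ω : Set (EuclideanSpace ℝ (Fin d))),
      (‖y.1.snd x‖ ^ p.toReal + ‖y.1.fst x‖ ^ p.toReal)) ^ (1 / p.toReal) := by
  have h0 : p ≠ 0 := (zero_lt_one.trans_le (Fact.out : 1 ≤ p)).ne'
  have hpos : 0 < p.toReal := ENNReal.toReal_pos h0 hp
  have key : ∀ {ι : Type} [Fintype ι] (f : Lp (EuclideanSpace ℝ ι) p
      (volume.restrict (Ω : Set (EuclideanSpace ℝ (Fin d))))),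
      ‖f‖ ^ p.toReal = ∫ x in (Ω : Set (EuclideanSpace ℝ (Fin d))), ‖f x‖ ^ p.toReal := by
    intro ι _ f
    have hn : 0 ≤ ∫ x in (Ω : Set (EuclideanSpace ℝ (Fin d))), ‖f x‖ ^ p.toReal :=
      integral_nonneg fun x => by positivity
    rw [Lp.norm_def, (Lp.memLp f).eLpNorm_eq_integral_rpow_norm h0 hp,
      ENNReal.toReal_ofReal (by positivity), Real.rpow_inv_rpow hn hpos.ne']
  rw [Submodule.coe_norm, WithLp.prod_norm_eq_add hpos, key, key,
    integral_add ((Lp.memLp y.1.snd).integrable_norm_rpow h0 hp)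
      ((Lp.memLp y.1.fst).integrable_norm_rpow h0 hp),
    add_comm (∫ x in (Ω : Set (EuclideanSpace ℝ (Fin d))), ‖y.1.fst x‖ ^ p.toReal)]

section Duality

variable {X Y : Type*} [NormedAddCommGroup X] [NormedSpace ℝ X]
  [NormedAddCommGroup Y] [NormedSpace ℝ Y]

/-- `λ* = sup_{x ∈ P} inf_{y ∈ Y, L(y) = 1} a(x, y)`, in the extended reals. -/
def lambdaStar (a : X →L[ℝ] Y →L[ℝ] ℝ) (L : Y →L[ℝ] ℝ) (P : Set X) : EReal :=
  ⨆ x ∈ P, ⨅ (y : Y) (_ : L y = 1), ((a x y : ℝ) : EReal)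

/-- `ζ* = inf_{y ∈ Y, L(y) = 1} sup_{x ∈ P} a(x, y)`, in the extended reals. -/
def zetaStar (a : X →L[ℝ] Y →L[ℝ] ℝ) (L : Y →L[ℝ] ℝ) (P : Set X) : EReal :=
  ⨅ (y : Y) (_ : L y = 1), ⨆ x ∈ P, ((a x y : ℝ) : EReal)

/-- `Λ_l = {x ∈ X | a(x, y) = l L(y) for all y ∈ Y}`. -/
def equilibriumSet (a : X →L[ℝ] Y →L[ℝ] ℝ) (L : Y →L[ℝ] ℝ) (l : ℝ) : Set X :=
  {x | ∀ y : Y, a x y = l * L y}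

/-- The dual problem has a solution: `λ*` is finite and `P ∩ Λ_{λ*}` is nonempty. -/
def DualProblemHasSolution (a : X →L[ℝ] Y →L[ℝ] ℝ) (L : Y →L[ℝ] ℝ) (P : Set X) : Prop :=
  ∃ l : ℝ, lambdaStar a L P = (l : EReal) ∧ (P ∩ equilibriumSet a L l).Nonempty

/-- The inf-sup condition on the cone `PC`:
`inf_{x ∈ PC, x ≠ 0} sup_{y ∈ Y, y ≠ 0} a(x, y) / (‖x‖ ‖y‖) > 0`, in the extended reals. -/
def InfSupCondition (a : X →L[ℝ] Y →L[ℝ] ℝ) (PC : Set X) : Prop :=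
  0 < ⨅ (x : X) (_ : x ∈ PC ∧ x ≠ 0), ⨆ (y : Y) (_ : y ≠ 0),
    ((a x y / (‖x‖ * ‖y‖) : ℝ) : EReal)

/-- Reflexivity: the canonical embedding into the bidual is onto. -/
def IsReflexiveSpace (X : Type*) [NormedAddCommGroup X] [NormedSpace ℝ X] : Prop :=
  Function.Surjective (NormedSpace.inclusionInDoubleDual ℝ X)

end Duality

end

/-! The infimum of `a x` over `L = 1` is `-∞` unless `a x = l • L`, in which case it is `l`, so `λ*`
is the supremum of the `l` with `l • L ∈ a '' P`. The inf-sup condition and the boundedness of `PA`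
give `β * ‖x‖ ≤ ‖a x‖ + C` on `P`; weak compactness then makes `a '' P` norm closed, so a finite
`λ*` is attained. For `ζ* ≤ λ*`, take `μ > λ*`, so that `μ • L ∉ a '' P`. Hahn–Banach would separate
by an element of the bidual of `Y`, but a point of `Y` is needed. So `P` is replaced by the cone
over `P × {1}`, on which `(x, t) ↦ t • μ • L - a x` is bounded below. An open-mapping style
iteration (`exists_dominating`) then dominates the functional `(x, t) ↦ t` on this cone by
evaluation at some `y : Y`: `a x y + 1 ≤ μ * L y` on `P`. Normalising `y` gives `ζ* ≤ μ`. -/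

/-! ### Weak compactness, closed images and cones -/

/-- Bounded closed convex subsets of a reflexive space are weakly compact. -/
theorem IsReflexiveSpace.isCompact_toWeakSpace_image {X : Type*} [NormedAddCommGroup X]
    [NormedSpace ℝ X] (hX : IsReflexiveSpace X) {s : Set X} (hs_closed : IsClosed s)
    (hs_convex : Convex ℝ s) (hs_bounded : Bornology.IsBounded s) :
    IsCompact (toWeakSpace ℝ X '' s) := by
  have h := NormedSpace.isCompact_closure_of_isBounded ℝ X (toWeakSpace ℝ X '' s)
    (by rwa [Set.preimage_image_eq _ (toWeakSpace ℝ X).injective]) (by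
      intro Φ _
      obtain ⟨x, hx⟩ := hX (WeakDual.toStrongDual Φ)
      refine ⟨toWeakSpace ℝ X x, ?_⟩
      refine DFunLike.ext _ _ fun f => ?_
      exact congrArg (fun Ψ : StrongDual ℝ (StrongDual ℝ X) => Ψ f) hx)
  rwa [← hs_convex.toWeakSpace_closure ℝ, hs_closed.closure_eq] at h

/-- A continuous linear map on a reflexive space which is coercive on a closed convex set maps this
set onto a closed set. -/
theorem IsReflexiveSpace.isClosed_image_of_coercive {X W : Type*} [NormedAddCommGroup X]
    [NormedSpace ℝ X] [NormedAddCommGroup W] [NormedSpace ℝ W] (hX : IsReflexiveSpace X)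
    {s : Set X} (hs_closed : IsClosed s) (hs_convex : Convex ℝ s) (A : X →L[ℝ] W) {β C : ℝ}
    (hβ : 0 < β) (hA : ∀ x ∈ s, β * ‖x‖ ≤ ‖A x‖ + C) : IsClosed (A '' s) := by
  refine isClosed_of_closure_subset fun η hη => ?_
  -- By coercivity, points of `s` with image within distance 1 of `η` have norm at most `R`.
  set R : ℝ := (‖η‖ + 1 + C) / β with hR
  have hcomp := (hX.isCompact_toWeakSpace_image (hs_closed.inter Metric.isClosed_closedBall)
    (hs_convex.inter (convex_closedBall (0 : X) R))
    (Metric.isBounded_closedBall.subset Set.inter_subset_right)).image (WeakSpace.map A).continuous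
  have hclosed : IsClosed (A '' (s ∩ Metric.closedBall 0 R)) := by
    have := hcomp.isClosed.preimage (toWeakSpaceCLM ℝ W).continuous
    convert this using 1
    ext w
    constructor
    · rintro ⟨x, hx, rfl⟩
      exact ⟨_, ⟨x, hx, rfl⟩, rfl⟩
    · rintro ⟨_, ⟨x, hx, rfl⟩, h⟩
      exact ⟨x, hx, (toWeakSpace ℝ W).injective h⟩
  have hmem : η ∈ closure (A '' (s ∩ Metric.closedBall 0 R)) := by
    rw [Metric.mem_closure_iff] at hη ⊢
    intro ε hε
    obtain ⟨_, ⟨x, hx, rfl⟩, hd⟩ := hη (min ε 1) (by positivity)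
    refine ⟨A x, ⟨x, ⟨hx, ?_⟩, rfl⟩, hd.trans_le (min_le_left _ _)⟩
    rw [mem_closedBall_zero_iff, hR, le_div_iff₀ hβ, mul_comm]
    have h1 : ‖A x‖ - ‖η‖ ≤ dist η (A x) := by
      rw [dist_eq_norm, norm_sub_rev]
      exact norm_sub_norm_le _ _
    linarith [hA x hx, hd.trans_le (min_le_right ε 1)]
  rw [hclosed.closure_eq] at hmem
  exact Set.image_mono Set.inter_subset_left hmem

/-- A product of a reflexive space with `ℝ` is reflexive. -/
theorem IsReflexiveSpace.prod_real {X : Type*} [NormedAddCommGroup X]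
    [NormedSpace ℝ X] (hX : IsReflexiveSpace X) : IsReflexiveSpace (X × ℝ) := by
  intro Φ
  obtain ⟨x, hx⟩ := hX (Φ.comp ((ContinuousLinearMap.compL ℝ (X × ℝ) X ℝ).flip
    (ContinuousLinearMap.fst ℝ X ℝ)))
  refine ⟨(x, Φ (ContinuousLinearMap.snd ℝ X ℝ)), ?_⟩
  ext f
  have hx' := congrArg (fun Ψ : StrongDual ℝ (StrongDual ℝ X) => Ψ
    (f.comp (ContinuousLinearMap.inl ℝ X ℝ))) hx
  have hf : f = (f.comp (ContinuousLinearMap.inl ℝ X ℝ)).comp (ContinuousLinearMap.fst ℝ X ℝ) +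
      f (0, 1) • ContinuousLinearMap.snd ℝ X ℝ := by
    ext <;> simp [Prod.mk_zero_zero]
  conv_rhs => rw [hf, map_add, map_smul]
  conv_lhs => rw [hf]
  simp only [NormedSpace.dual_def, ContinuousLinearMap.comp_apply,
    ContinuousLinearMap.flip_apply, ContinuousLinearMap.compL_apply] at hx' ⊢
  simp [← hx']

/-- A point at which every continuous linear functional that is nonnegative on a nonempty convex
cone is nonnegative belongs to the closure of the cone. -/
theorem ConvexCone.mem_closure_of_forall_dual_nonneg {V : Type*} [NormedAddCommGroup V]
    [NormedSpace ℝ V] (K : ConvexCone ℝ V) (hK : (K : Set V).Nonempty) {v : V}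
    (hv : ∀ f : StrongDual ℝ V, (∀ k ∈ K, 0 ≤ f k) → 0 ≤ f v) : v ∈ closure (K : Set V) := by
  by_contra hmem
  obtain ⟨f, u, hfv, hf⟩ := geometric_hahn_banach_point_closed K.convex.closure isClosed_closure hmem
  have hscale : ∀ k ∈ K, ∀ t : ℝ, 0 < t → u < t * f k := fun k hk t ht => by
    simpa using hf _ (subset_closure (K.smul_mem ht hk))
  have hnonneg : ∀ k ∈ K, 0 ≤ f k := by
    intro k hk
    by_contra! hneg
    -- This multiple of `k` has value `-(|u| + 1)`, which is below `u`.
    have h := hscale k hk ((|u| + 1) / (-f k)) (div_pos (by positivity) (by linarith))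
    have h' : (|u| + 1) / (-f k) * f k = -(|u| + 1) := by
      rw [div_neg, neg_mul, div_mul_cancel₀ _ hneg.ne]
    linarith [neg_abs_le u]
  obtain ⟨k, hk⟩ := hK
  have hu : u ≤ 0 := by
    have ht : Filter.Tendsto (fun t : ℝ => t * f k) (nhdsWithin 0 (Set.Ioi 0)) (nhds (0 * f k)) :=
      ((continuous_id.mul continuous_const).tendsto 0).mono_left nhdsWithin_le_nhds
    rw [zero_mul] at ht
    exact ge_of_tendsto ht (eventually_mem_nhdsWithin.mono fun t ht => (hscale k hk t ht).le)
  linarith [hv f hnonneg]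

/-! ### Dominating functionals on a cone -/

section ConeSurjectivity

variable {V Y : Type*} [NormedAddCommGroup V] [NormedSpace ℝ V]
  [NormedAddCommGroup Y] [NormedSpace ℝ Y]

/-- If the bilinear form `B` is bounded below on the cone `K`, then every functional is dominated
on `K` by some `B · y` up to a functional of half its norm. -/
theorem IsReflexiveSpace.exists_approx_dominating (hV : IsReflexiveSpace V)
    (B : V →L[ℝ] Y →L[ℝ] ℝ) (K : ConvexCone ℝ V) (hK : (K : Set V).Nonempty) {β : ℝ} (hβ : 0 < β)
    (hB : ∀ k ∈ K, β * ‖k‖ ≤ ‖B k‖) (ξ : StrongDual ℝ V) :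
    ∃ (y : Y) (e : StrongDual ℝ V), ‖y‖ ≤ ‖ξ‖ / β ∧ ‖e‖ ≤ ‖ξ‖ / 2 ∧
      ∀ k ∈ K, ξ k ≤ B k y + e k := by
  rcases eq_or_ne ξ 0 with rfl | hξ
  · exact ⟨0, 0, by simp, by simp, by simp⟩
  have hξ' : 0 < ‖ξ‖ := norm_pos_iff.2 hξ
  have hC : 0 < ‖ξ‖ / β := by positivity
  let S : Set (StrongDual ℝ V) := {η | ∃ y : Y, ‖y‖ ≤ ‖ξ‖ / β ∧ ∀ k ∈ K, η k ≤ B k y}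
  have hS : Convex ℝ S := by
    rintro η₁ ⟨y₁, hy₁, h₁⟩ η₂ ⟨y₂, hy₂, h₂⟩ s t hs ht hst
    refine ⟨s • y₁ + t • y₂, ?_, fun k hk => ?_⟩
    · have := convex_closedBall (0 : Y) (‖ξ‖ / β) (mem_closedBall_zero_iff.2 hy₁)
        (mem_closedBall_zero_iff.2 hy₂) hs ht hst
      exact mem_closedBall_zero_iff.1 this
    · simpa using add_le_add (mul_le_mul_of_nonneg_left (h₁ k hk) hs)
        (mul_le_mul_of_nonneg_left (h₂ k hk) ht)
  suffices hmem : ξ ∈ closure S by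
    obtain ⟨η, ⟨y, hy, hη⟩, hd⟩ := Metric.mem_closure_iff.1 hmem (‖ξ‖ / 2) (by positivity)
    refine ⟨y, ξ - η, hy, ?_, fun k hk => ?_⟩
    · rw [← dist_eq_norm]
      exact hd.le
    · have := hη k hk
      simp only [sub_apply]
      linarith
  by_contra hmem
  obtain ⟨Φ, u, hΦξ, hΦ⟩ := geometric_hahn_banach_point_closed hS.closure isClosed_closure hmem
  obtain ⟨v, rfl⟩ := hV Φ
  simp only [NormedSpace.dual_def] at hΦξ hΦ
  -- `S` contains every negative multiple of a functional `f` that is nonnegative on `K`;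
  -- boundedness below at `v` forces `f v ≤ 0`.
  have hcl : -v ∈ closure (K : Set V) := by
    refine K.mem_closure_of_forall_dual_nonneg hK fun f hf => ?_
    rw [map_neg, neg_nonneg]
    by_contra! hpos
    have hmem : -((|u| + 1) / f v) • f ∈ S := by
      refine ⟨0, by simpa using hC.le, fun k hk => ?_⟩
      have : 0 ≤ (|u| + 1) / f v * f k := mul_nonneg (by positivity) (hf k hk)
      simpa using this
    have h := hΦ _ (subset_closure hmem)
    have h' : (|u| + 1) / f v * f v = |u| + 1 := by field_simp
    simp only [smul_apply, smul_eq_mul, neg_mul, h'] at h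
    linarith [neg_abs_le u]
  have hBv : β * ‖v‖ ≤ ‖B v‖ := by
    have hclosed : IsClosed {k : V | β * ‖k‖ ≤ ‖B k‖} :=
      isClosed_le (by fun_prop) (by fun_prop)
    have h : β * ‖-v‖ ≤ ‖B (-v)‖ := closure_minimal hB hclosed hcl
    simpa using h
  -- `S` also contains `B · y` for `y` in the ball of radius `‖ξ‖ / β`. Hence `‖ξ‖ * ‖v‖ ≤ -u < -ξ
  -- v`, which is absurd.
  have hball : ∀ y : Y, ‖y‖ ≤ ‖ξ‖ / β → u < B v y := by
    intro y hy
    have := hΦ (B.flip y) (subset_closure ⟨y, hy, fun k _ => le_rfl⟩)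
    simpa using this
  have hu : 0 ≤ -u := by
    have := hball 0 (by simpa using hC.le)
    simp only [map_zero] at this
    linarith
  have hnorm : ‖B v‖ ≤ -u / (‖ξ‖ / β) := by
    refine ContinuousLinearMap.opNorm_le_bound _ (by positivity) fun y => ?_
    refine LinearMap.bound_of_ball_bound' hC (-u) (B v).toLinearMap (fun z hz => ?_) y
    have h1 := hball z (mem_closedBall_zero_iff.1 hz)
    have h2 := hball (-z) (by simpa using mem_closedBall_zero_iff.1 hz)
    rw [map_neg] at h2
    exact abs_le.2 ⟨by simpa using h1.le, by simpa using (by linarith : B v z ≤ -u)⟩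
  rw [le_div_iff₀ hC] at hnorm
  have h1 : ‖ξ‖ * ‖v‖ ≤ -u := by
    calc ‖ξ‖ * ‖v‖ = β * ‖v‖ * (‖ξ‖ / β) := by field_simp
      _ ≤ ‖B v‖ * (‖ξ‖ / β) := by gcongr
      _ ≤ -u := hnorm
  have h2 := (abs_le.1 ((Real.norm_eq_abs _).symm.trans_le (ξ.le_opNorm v))).1
  linarith

/-- If the bilinear form `B` is bounded below on the cone `K`, then every functional is dominated
on `K` by some `B · y`. -/
theorem IsReflexiveSpace.exists_dominating [CompleteSpace Y] (hV : IsReflexiveSpace V)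
    (B : V →L[ℝ] Y →L[ℝ] ℝ) (K : ConvexCone ℝ V) (hK : (K : Set V).Nonempty) {β : ℝ} (hβ : 0 < β)
    (hB : ∀ k ∈ K, β * ‖k‖ ≤ ‖B k‖) (ξ : StrongDual ℝ V) :
    ∃ y : Y, ∀ k ∈ K, ξ k ≤ B k y := by
  choose f g hf hg hfg using hV.exists_approx_dominating B K hK hβ hB
  -- Successive errors: each is dominated up to the next, and their norms halve, so the corrections
  -- `f (e n)` are summable in the complete space `Y`.
  let e : ℕ → StrongDual ℝ V := fun n => g^[n] ξ
  have he_succ : ∀ n, e (n + 1) = g (e n) := fun n => Function.iterate_succ_apply' g n ξ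
  have he : ∀ n, ‖e n‖ ≤ ‖ξ‖ * (1 / 2) ^ n := by
    intro n
    induction n with
    | zero => simp [e]
    | succ n ih =>
      rw [he_succ, pow_succ]
      linarith [hg (e n)]
  have hsum : Summable fun n => f (e n) := by
    refine Summable.of_norm_bounded (g := fun n : ℕ => ‖ξ‖ / β * (1 / 2) ^ n)
      (summable_geometric_two.mul_left _) fun n => (hf _).trans ?_
    rw [div_mul_eq_mul_div]
    gcongr
    exact he n
  refine ⟨∑' n, f (e n), fun k hk => ?_⟩
  have hpart : ∀ n, ξ k ≤ B k (∑ i ∈ Finset.range n, f (e i)) + e n k := by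
    intro n
    induction n with
    | zero => simp [e]
    | succ n ih =>
      rw [Finset.sum_range_succ, map_add, he_succ]
      linarith [hfg (e n) k hk]
  have he0 : Filter.Tendsto e Filter.atTop (nhds 0) := by
    refine squeeze_zero_norm he ?_
    simpa using (tendsto_pow_atTop_nhds_zero_of_lt_one (r := (1 / 2 : ℝ))
      (by norm_num) (by norm_num)).const_mul ‖ξ‖
  have hlim : Filter.Tendsto (fun n => B k (∑ i ∈ Finset.range n, f (e i)) + e n k) Filter.atTop
      (nhds (B k (∑' n, f (e n)) + (0 : StrongDual ℝ V) k)) :=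
    (((B k).continuous.tendsto _).comp hsum.hasSum.tendsto_sum_nat).add
      (((ContinuousLinearMap.apply ℝ ℝ k).continuous.tendsto _).comp he0)
  simpa using ge_of_tendsto' hlim hpart

end ConeSurjectivity

/-! ### Separation, coercivity and strong duality -/

section Duality

variable {X Y : Type*} [NormedAddCommGroup X] [NormedSpace ℝ X]
  [NormedAddCommGroup Y] [NormedSpace ℝ Y]

/-- A functional outside the image of a closed convex set under a coercive map into a dual space
is separated from this image by a point of the predual. -/
theorem IsReflexiveSpace.exists_separating_of_notMem_image [CompleteSpace Y]
    (hX : IsReflexiveSpace X) (A : X →L[ℝ] Y →L[ℝ] ℝ) {P : Set X} (hP_closed : IsClosed P)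
    (hP_convex : Convex ℝ P) (hP : P.Nonempty) {β C : ℝ} (hβ : 0 < β)
    (hA : ∀ x ∈ P, β * ‖x‖ ≤ ‖A x‖ + C) {η : Y →L[ℝ] ℝ} (hη : η ∉ A '' P) :
    ∃ y : Y, ∀ x ∈ P, A x y + 1 ≤ η y := by
  obtain ⟨δ, hδ, hδP⟩ : ∃ δ > 0, ∀ x ∈ P, δ ≤ ‖η - A x‖ := by
    have hcl := hX.isClosed_image_of_coercive hP_closed hP_convex A hβ hA
    rw [← hcl.closure_eq, Metric.mem_closure_iff] at hη
    push Not at hη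
    obtain ⟨δ, hδ, h⟩ := hη
    exact ⟨δ, hδ, fun x hx => by simpa [dist_eq_norm] using h _ ⟨x, hx, rfl⟩⟩
  let B : X × ℝ →L[ℝ] Y →L[ℝ] ℝ :=
    (ContinuousLinearMap.snd ℝ X ℝ).smulRight η - A.comp (ContinuousLinearMap.fst ℝ X ℝ)
  have hB_apply : ∀ x t, B (x, t) = t • η - A x := fun x t => rfl
  have hconv := hP_convex.prod (convex_singleton (1 : ℝ))
  set D : ℝ := |C| + ‖η‖ with hD
  have hD0 : 0 ≤ D := by positivity
  -- Since `‖η - A x‖ ≥ δ`, the additive constants `D` and `1` are absorbed as multiples of `‖η - A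
  -- x‖`.
  set M : ℝ := (1 + D / δ) / β + 1 / δ with hM
  have hM0 : 0 < M := by positivity
  have hbound : ∀ x ∈ P, ‖((x, 1) : X × ℝ)‖ ≤ M * ‖B (x, 1)‖ := by
    intro x hx
    rw [hB_apply, one_smul]
    have h1 := hδP x hx
    set N := ‖η - A x‖ with hN
    have hN0 : 0 < N := hδ.trans_le h1
    have h2 : β * ‖x‖ ≤ N + D := by
      have : ‖A x‖ ≤ ‖η‖ + N := by simpa [hN] using norm_sub_le η (η - A x)
      linarith [hA x hx, le_abs_self C]
    have h3 : ‖x‖ ≤ (1 + D / δ) / β * N := by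
      rw [div_mul_eq_mul_div, le_div_iff₀ hβ, mul_comm]
      have : D ≤ D / δ * N := by
        rw [div_mul_eq_mul_div, le_div_iff₀ hδ]
        exact mul_le_mul_of_nonneg_left h1 hD0
      linarith
    have h4 : 1 ≤ 1 / δ * N := by
      rw [one_div_mul_eq_div, one_le_div hδ]
      exact h1
    have h5 : 0 ≤ (1 + D / δ) / β * N := by positivity
    rw [Prod.norm_mk, hM, add_mul]
    exact max_le (by linarith) (by rw [norm_one]; linarith)
  obtain ⟨y, hy⟩ := hX.prod_real.exists_dominating B (ConvexCone.hull ℝ (P ×ˢ {1}))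
    ((hP.prod (Set.singleton_nonempty 1)).mono ConvexCone.subset_hull) (inv_pos.2 hM0) (by
      intro k hk
      obtain ⟨c, hc, ⟨x, t⟩, ⟨hx, ht⟩, rfl⟩ := (ConvexCone.mem_hull_of_convex hconv).1 hk
      obtain rfl : t = 1 := ht
      rw [map_smul, norm_smul, norm_smul, inv_mul_le_iff₀ hM0, mul_left_comm]
      exact mul_le_mul_of_nonneg_left (hbound x hx) (norm_nonneg c))
    (ContinuousLinearMap.snd ℝ X ℝ)
  refine ⟨y, fun x hx => ?_⟩
  have h := hy (x, 1) (ConvexCone.subset_hull ⟨hx, rfl⟩)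
  simp only [hB_apply, one_smul, ContinuousLinearMap.coe_snd', sub_apply] at h
  linarith

/-- The inf-sup condition gives a lower bound for `a` on the cone. -/
theorem InfSupCondition.exists_le_norm {a : X →L[ℝ] Y →L[ℝ] ℝ} {PC : Set X}
    (h : InfSupCondition a PC) : ∃ β > 0, ∀ x ∈ PC, β * ‖x‖ ≤ ‖a x‖ := by
  obtain ⟨β, hβ0, hβ⟩ := EReal.lt_iff_exists_real_btwn.1 h
  refine ⟨β, EReal.coe_pos.1 hβ0, fun x hx => ?_⟩
  rcases eq_or_ne x 0 with rfl | hx0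
  · simp
  have h1 := hβ.trans_le (iInf₂_le x ⟨hx, hx0⟩)
  simp only [lt_iSup_iff] at h1
  obtain ⟨y, hy0, hy⟩ := h1
  have h2 : β < a x y / (‖x‖ * ‖y‖) := EReal.coe_lt_coe_iff.1 hy
  have hxn := norm_pos_iff.2 hx0
  have hyn := norm_pos_iff.2 hy0
  rw [lt_div_iff₀ (by positivity)] at h2
  have h3 := (le_abs_self _).trans ((a x).le_opNorm y)
  nlinarith

/-- Coercivity on the whole of `P`, from a lower bound on the cone `PC` and `P ⊆ PA + PC` with `PA`
bounded. -/
theorem InfSupCondition.exists_coercive {a : X →L[ℝ] Y →L[ℝ] ℝ} {P PA PC : Set X}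
    (h : InfSupCondition a PC) (hPA : Bornology.IsBounded PA)
    (h_decomp : ∀ x ∈ P, ∃ xA ∈ PA, ∃ xC ∈ PC, x = xA + xC) :
    ∃ β > 0, ∃ C, ∀ x ∈ P, β * ‖x‖ ≤ ‖a x‖ + C := by
  obtain ⟨β, hβ, hPC⟩ := h.exists_le_norm
  obtain ⟨M, hM⟩ := hPA.exists_norm_le
  refine ⟨β, hβ, β * M + ‖a‖ * M, fun x hx => ?_⟩
  obtain ⟨xA, hxA, xC, hxC, rfl⟩ := h_decomp x hx
  have h1 : β * ‖xA + xC‖ ≤ β * (M + ‖xC‖) := by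
    gcongr
    exact (norm_add_le _ _).trans (by linarith [hM xA hxA])
  have h2 : ‖a xC‖ ≤ ‖a (xA + xC)‖ + ‖a xA‖ := by
    simpa using norm_sub_le (a (xA + xC)) (a xA)
  have h3 : ‖a xA‖ ≤ ‖a‖ * M := (a.le_opNorm xA).trans (by gcongr; exact hM xA hxA)
  linarith [hPC xC hxC]

/-- Weak duality. -/
theorem lambdaStar_le_zetaStar (a : X →L[ℝ] Y →L[ℝ] ℝ) (L : Y →L[ℝ] ℝ) (P : Set X) :
    lambdaStar a L P ≤ zetaStar a L P :=
  iSup₂_le fun x hx => le_iInf₂ fun y hy =>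
    (iInf₂_le y hy).trans (le_iSup₂ (f := fun x (_ : x ∈ P) => ((a x y : ℝ) : EReal)) x hx)

theorem le_lambdaStar_of_eq_smul {a : X →L[ℝ] Y →L[ℝ] ℝ} {L : Y →L[ℝ] ℝ} {P : Set X} {x : X}
    (hx : x ∈ P) {l : ℝ} (h : a x = l • L) : (l : EReal) ≤ lambdaStar a L P := by
  refine le_trans (le_iInf₂ fun y hy => ?_)
    (le_iSup₂ (f := fun x (_ : x ∈ P) => ⨅ (y : Y) (_ : L y = 1), ((a x y : ℝ) : EReal)) x hx)
  simp [h, hy]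

/-- A functional bounded below on the hyperplane `L = 1` is a multiple of `L`. -/
theorem ContinuousLinearMap.eq_smul_of_bddBelow {L f : Y →L[ℝ] ℝ} {y₀ : Y} (hy₀ : L y₀ = 1) {c : ℝ}
    (hc : ∀ y, L y = 1 → c ≤ f y) : f = f y₀ • L := by
  have hker : ∀ z, L z = 0 → f z = 0 := by
    intro z hz
    by_contra hne
    -- At this point of the hyperplane `f` would equal `c - 1`.
    have h := hc (y₀ + ((c - f y₀ - 1) / f z) • z) (by simp [hy₀, hz])
    rw [map_add, map_smul, smul_eq_mul, div_mul_cancel₀ _ hne] at h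
    linarith
  ext y
  have h := hker (y - L y • y₀) (by simp [hy₀])
  simp only [map_sub, map_smul, smul_eq_mul, smul_apply] at h ⊢
  linarith

/-- Only those `x` with `a x` a multiple of `L` have an inner infimum above `-∞`. -/
theorem lambdaStar_le_of_forall {a : X →L[ℝ] Y →L[ℝ] ℝ} {L : Y →L[ℝ] ℝ} (hL : L ≠ 0)
    {P : Set X} {b : EReal} (h : ∀ x ∈ P, ∀ l : ℝ, a x = l • L → (l : EReal) ≤ b) :
    lambdaStar a L P ≤ b := by
  obtain ⟨z, hz⟩ : ∃ z, L z ≠ 0 := by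
    by_contra! h
    exact hL (ContinuousLinearMap.ext h)
  have hy₀ : L ((L z)⁻¹ • z) = 1 := by simp [hz]
  refine iSup₂_le fun x hx => ?_
  by_contra! hlt
  obtain ⟨c, -, hc⟩ := EReal.lt_iff_exists_real_btwn.1 hlt
  have hc' : ∀ y, L y = 1 → c ≤ a x y := fun y hy =>
    EReal.coe_le_coe_iff.1 (hc.le.trans (iInf₂_le y hy))
  have h1 := h x hx _ (ContinuousLinearMap.eq_smul_of_bddBelow hy₀ hc')
  exact (hlt.trans_le (le_trans (iInf₂_le ((L z)⁻¹ • z) hy₀) h1)).false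

/-- Strong duality and dual attainment for a form which is coercive on `P`. -/
theorem lambdaStar_eq_zetaStar_of_coercive [CompleteSpace Y] (hX : IsReflexiveSpace X)
    (a : X →L[ℝ] Y →L[ℝ] ℝ) {L : Y →L[ℝ] ℝ} (hL : L ≠ 0) {P : Set X} (hP_closed : IsClosed P)
    (hP_convex : Convex ℝ P) (hP_zero : (0 : X) ∈ P) {β C : ℝ} (hβ : 0 < β)
    (ha : ∀ x ∈ P, β * ‖x‖ ≤ ‖a x‖ + C) :
    lambdaStar a L P = zetaStar a L P ∧
      (lambdaStar a L P < ⊤ → DualProblemHasSolution a L P) := by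
  rcases eq_or_ne (lambdaStar a L P) ⊤ with htop | htop
  · have h := lambdaStar_le_zetaStar a L P
    rw [htop] at h ⊢
    exact ⟨(top_le_iff.1 h).symm, fun h => (lt_irrefl _ h).elim⟩
  let T : Set ℝ := {l | l • L ∈ a '' P}
  have hT_closed : IsClosed T :=
    (hX.isClosed_image_of_coercive hP_closed hP_convex a hβ ha).preimage
      (continuous_id.smul continuous_const)
  have hT_zero : (0 : ℝ) ∈ T := ⟨0, hP_zero, by simp⟩
  have hT_le : ∀ l ∈ T, (l : EReal) ≤ lambdaStar a L P := by
    rintro l ⟨x, hx, hl⟩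
    exact le_lambdaStar_of_eq_smul hx hl
  have hbot : lambdaStar a L P ≠ ⊥ := ((EReal.bot_lt_coe 0).trans_le (hT_le 0 hT_zero)).ne'
  lift lambdaStar a L P to ℝ using ⟨htop, hbot⟩ with Λ hΛ
  have hT_bdd : BddAbove T := ⟨Λ, fun l hl => EReal.coe_le_coe_iff.1 (hT_le l hl)⟩
  have hmem : sSup T ∈ T := hT_closed.csSup_mem ⟨0, hT_zero⟩ hT_bdd
  have hΛT : Λ = sSup T := by
    refine le_antisymm (EReal.coe_le_coe_iff.1 ?_) (EReal.coe_le_coe_iff.1 (hT_le _ hmem))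
    rw [hΛ]
    exact lambdaStar_le_of_forall hL fun x hx l hl =>
      EReal.coe_le_coe_iff.2 (le_csSup hT_bdd ⟨x, hx, hl⟩)
  refine ⟨le_antisymm (hΛ ▸ lambdaStar_le_zetaStar a L P) ?_, fun _ => ?_⟩
  · rw [← EReal.le_of_forall_lt_iff_le]
    intro μ hμ
    have hμT : sSup T < μ := hΛT ▸ EReal.coe_lt_coe_iff.1 hμ
    have hμ0 : 0 < μ := (le_csSup hT_bdd hT_zero).trans_lt hμT
    obtain ⟨y, hy⟩ := hX.exists_separating_of_notMem_image a hP_closed hP_convex ⟨0, hP_zero⟩ hβ ha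
      (η := μ • L) fun h => (le_csSup hT_bdd h).not_gt hμT
    simp only [smul_apply, smul_eq_mul] at hy
    -- The point `0 ∈ P` gives `1 ≤ μ * L y`.
    have hLy : 0 < L y := by
      have := hy 0 hP_zero
      simp only [map_zero, zero_apply] at this
      exact pos_of_mul_pos_right (by linarith : 0 < μ * L y) hμ0.le
    refine (iInf₂_le ((L y)⁻¹ • y) (by simp [hLy.ne'])).trans
      (iSup₂_le fun x hx => EReal.coe_le_coe_iff.2 ?_)
    rw [map_smul, smul_eq_mul, inv_mul_le_iff₀ hLy]
    linarith [hy x hx]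
  · obtain ⟨x, hx, hax⟩ := hmem
    refine ⟨Λ, hΛ.symm, x, hx, fun y => ?_⟩
    rw [hax, hΛT]
    rfl

end Duality

/-! ### Completeness of the Sobolev space -/

section Sobolev

variable {d m : ℕ} (p : ℝ≥0∞) [Fact (1 ≤ p)]

/-- Integration of a component against a continuous compactly supported function is continuous
on `Lᵖ`. -/
theorem continuous_integral_component_mul {ι : Type} [Fintype ι]
    (μ : Measure (EuclideanSpace ℝ (Fin d))) [IsFiniteMeasureOnCompacts μ] (i : ι)
    {φ : EuclideanSpace ℝ (Fin d) → ℝ} (hφ : Continuous φ) (hc : HasCompactSupport φ) :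
    Continuous fun f : Lp (EuclideanSpace ℝ ι) p μ => ∫ x, f x i * φ x ∂μ := by
  have hpq : p.HolderConjugate p.conjExponent := ENNReal.HolderConjugate.conjExponent Fact.out
  have : Fact (1 ≤ p.conjExponent) := ⟨hpq.symm.one_le⟩
  have hmem : MemLp φ p.conjExponent μ := hφ.memLp_of_hasCompactSupport hc
  let B : EuclideanSpace ℝ ι →L[ℝ] ℝ →L[ℝ] ℝ :=
    (ContinuousLinearMap.mul ℝ ℝ).comp (EuclideanSpace.proj i)
  have hB : ∀ f : Lp (EuclideanSpace ℝ ι) p μ, ∫ x, f x i * φ x ∂μ =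
      B.lpPairing μ p p.conjExponent f (hmem.toLp φ) := by
    intro f
    rw [ContinuousLinearMap.lpPairing_eq_integral]
    refine integral_congr_ae ?_
    filter_upwards [hmem.coeFn_toLp] with x hx
    rw [hx]
    rfl
  simp_rw [hB]
  exact ((B.lpPairing μ p p.conjExponent).flip (hmem.toLp φ)).continuous

/-- Each test function imposes an equality between two continuous functionals of `(u, G)`. -/
theorem isClosed_sobolevSubmodule (Ω : Opens (EuclideanSpace ℝ (Fin d))) (m : ℕ) :
    IsClosed (sobolevSubmodule p Ω m).carrier := by
  change IsClosed {w : WithLp p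
    (Lp (EuclideanSpace ℝ (Fin m)) p (volume.restrict (Ω : Set (EuclideanSpace ℝ (Fin d)))) ×
      Lp (EuclideanSpace ℝ (Fin m × Fin d)) p
        (volume.restrict (Ω : Set (EuclideanSpace ℝ (Fin d))))) | IsWeakGradient Ω w.fst w.snd}
  simp only [IsWeakGradient, Set.ofPred_forall]
  refine isClosed_iInter fun φ => isClosed_iInter fun hφ => isClosed_iInter fun hc =>
    isClosed_iInter fun _ => isClosed_iInter fun i => isClosed_iInter fun j => ?_
  have hd : Continuous (fun x => fderiv ℝ φ x (EuclideanSpace.single j 1)) :=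
    (hφ.continuous_fderiv (by simp)).clm_apply continuous_const
  have hdc : HasCompactSupport (fun x => fderiv ℝ φ x (EuclideanSpace.single j 1)) :=
    hc.fderiv_apply ℝ _
  exact isClosed_eq
    ((continuous_integral_component_mul p _ i hd hdc).comp (WithLp.continuous_fst _ _ _))
    ((continuous_integral_component_mul p _ (i, j) hφ.continuous hc).comp
      (WithLp.continuous_snd _ _ _)).neg

instance SobolevSpace.instCompleteSpace (Ω : Opens (EuclideanSpace ℝ (Fin d))) (m : ℕ) :
    CompleteSpace (SobolevSpace p Ω m) :=
  (isClosed_sobolevSubmodule p Ω m).completeSpace_coe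

end Sobolev
theorem mainTheorem4
    {d m : ℕ} (Ω : Opens (EuclideanSpace ℝ (Fin d)))
    (p : ℝ≥0∞) [Fact (1 ≤ p)] (hp_one : 1 < p) (hp_top : p ≠ ⊤)
    {X : Type*} [NormedAddCommGroup X] [NormedSpace ℝ X] [CompleteSpace X]
    (hX : IsReflexiveSpace X)
    (a : X →L[ℝ] SobolevSpace p Ω m →L[ℝ] ℝ)
    (L : SobolevSpace p Ω m →L[ℝ] ℝ) (hL : L ≠ 0)
    (P : Set X) (hP_closed : IsClosed P) (hP_convex : Convex ℝ P) (hP_zero : (0 : X) ∈ P)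
    (PA : Set X) (hPA_closed : IsClosed PA) (hPA_convex : Convex ℝ PA)
    (hPA_bounded : Bornology.IsBounded PA)
    (PC : ConvexCone ℝ X) (hPC_closed : IsClosed (PC : Set X)) (hPC_sub : (PC : Set X) ⊆ P)
    (h_decomp : ∀ x ∈ P, ∃ xA ∈ PA, ∃ xC ∈ PC, x = xA + xC)
    (h_infsup : InfSupCondition a (PC : Set X)) :
    lambdaStar a L P = zetaStar a L P ∧
      (lambdaStar a L P < ⊤ → DualProblemHasSolution a L P) := by

  obtain ⟨β, hβ, C, ha⟩ := h_infsup.exists_coercive hPA_bounded h_decomp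
  exact lambdaStar_eq_zetaStar_of_coercive hX a hL hP_closed hP_convex hP_zero hβ ha
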